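/- Let $C_L$ be the class of functions $f:[0,1]\to\mathbb{R}$ that are differentiable on $[0,1]$ (one-sidedly at the endpoints) and whose derivative $f'$ is Lipschitz on $[0,1]$. For an orthonormal system $\varphi=(\varphi_n)_{n\ge 1}$ of real functions in $L_2[0,1]$ and $f\in L_2[0,1]$, put $$C_n(f,\varphi)=\int_0^1 f(u)\varphi_n(u)\,du,\qquad S_n(x,f,\varphi)=\sum_{k=1}^{n} C_k(f,\varphi)\,\varphi_k(x),$$ and say that $f\in E(\varphi)$ at the point $x\in[0,1]$ if $S_n(x,f,\varphi)=O(1)$ as $n\to\infty$. Theorem. There exist a function $g\in C_L$ and an orthonormal system $(G_n)_{n\ge1}$ on $[0,1]$ such that $$\int_0^1 G_n(u)\,du=0,\qquad \int_0^1 u\,G_n(u)\,du=0\qquad (n=1,2,\dots)$$ (so that $q(u)=1$ and $p(u)=u$ belong to $E(G)$ at every point $x\in[0,1]$), and nevertheless $$\limsup_{n\to\infty}\bigl|S_n(x,g,G)\bigr|=+\infty\qquad\text{for almost every } x\in[0,1].$$ In particular, the hypotheses $p,q\in E(\varphi)$ alone do not guarantee bounded partial sums for functions in $C_L$. -/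

import Mathlib

open Set Filter MeasureTheory Asymptotics

noncomputable section

namespace GeneralFourier

/-- The class `Lip1` of Lipschitz functions on `[0,1]`. -/
def Lip1 : Set (ℝ → ℝ) :=
  {f | ∃ K : NNReal, LipschitzOnWith K f (Icc 0 1)}

/-- The class `C_L`: functions differentiable on `[0,1]` (one-sidedly at the endpoints) whose
derivative belongs to `Lip1`. -/
def classCL : Set (ℝ → ℝ) :=
  {f | DifferentiableOn ℝ f (Icc 0 1) ∧ derivWithin f (Icc 0 1) ∈ Lip1}

/-- `f ∈ L₂[0,1]`. -/
def InL2 (f : ℝ → ℝ) : Prop :=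
  MemLp f 2 (volume.restrict (Icc (0 : ℝ) 1))

/-- `φ` is an orthonormal system on `[0,1]`. The function usually written `φ_{k+1}`
is `φ k`, so the index runs over `k = 0, 1, 2, …`. -/
def IsONS (φ : ℕ → ℝ → ℝ) : Prop :=
  (∀ n, InL2 (φ n)) ∧
    ∀ m n, ∫ u in (0 : ℝ)..1, φ m u * φ n u = if m = n then 1 else 0

/-- Fourier coefficient of `f` with respect to `φ`. -/
def coeff (φ : ℕ → ℝ → ℝ) (f : ℝ → ℝ) (k : ℕ) : ℝ :=
  ∫ u in (0 : ℝ)..1, f u * φ k u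

/-- The sum of the first `n` terms of the Fourier series of `f` with respect to `φ`, at `x`. -/
def partialSum (φ : ℕ → ℝ → ℝ) (n : ℕ) (x : ℝ) (f : ℝ → ℝ) : ℝ :=
  ∑ k ∈ Finset.range n, coeff φ f k * φ k x

/-- The class `E(φ)` at the point `x`: functions in `L₂[0,1]` whose Fourier partial sums
at `x` are `O(1)`. -/
def classE (φ : ℕ → ℝ → ℝ) (x : ℝ) : Set (ℝ → ℝ) :=
  {f | InL2 f ∧ (fun n => partialSum φ n x f) =O[atTop] (fun _ => (1 : ℝ))}

end GeneralFourier

end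

/-! Take `g = u²`. It suffices to have mean-zero orthonormal functions `ψ` and `c ∈ ℓ²` such that `∑
c k ψ k` has unbounded partial sums almost everywhere (`exists_orthonormal_unbounded`), and to move
this system by a unitary `R` of `L₂[0,1]`. Put `F = ∑ c (n+1) ψ (n+1)`. Up to scalars, `R` sends `ψ
0` to `u - 1/2` and `F` to `u² - u + 1/6`, and it fixes `1`. Hence `G n = R (ψ (n+1))` is orthogonal
to `1` and `u`, while its coefficients of `u²` are proportional to `c (n+1)`. Since `R` is the
identity plus an operator of rank two, it changes the partial sums at almost every point by a
bounded amount (`ae_unbounded_of_rank_two`).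

The divergent series comes from Haar functions of `N` levels in right-to-left order: at each point
all values `+1` precede all values `-1`, so some partial sum is of size `N`, although the squares
sum only to `N`. Blocks with sparse weights, made mutually orthogonal by independence, give
divergence with finite total energy. -/

open scoped RealInnerProductSpace

/-! ### Haar functions in right-to-left order -/

/-- The unnormalised Haar functions of the levels `0, …, N - 1` on `[0,1)`, numbered from right to
left by the midpoints of their supports: the function with midpoint `t / 2 ^ N` has the number
`2 ^ N - t`, and the number `0` is given to the zero function. -/
noncomputable def haarTree : ℕ → ℕ → ℝ → ℝ
  | 0, _, _ => 0
  | N + 1, i, y =>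
    if y < 1 / 2 then
      if i < 2 ^ N then 0 else (if i = 2 ^ N then 1 else 0) + haarTree N (i - 2 ^ N) (2 * y)
    else
      if i < 2 ^ N then haarTree N i (2 * y - 1) else if i = 2 ^ N then -1 else 0

/-- The root of a tree shares its number `2 ^ N` with slot `0` of the left subtree, so that slot
must contribute nothing. -/
lemma haarTree_slot_zero (N : ℕ) (y : ℝ) : haarTree N 0 y = 0 := by
  induction N generalizing y with
  | zero => rfl
  | succ N ih => simp [haarTree, ih]

lemma measurable_haarTree (N i : ℕ) : Measurable (haarTree N i) := by
  induction N generalizing i with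
  | zero => exact measurable_const
  | succ N ih =>
    have h1 : Measurable fun y : ℝ => haarTree N (i - 2 ^ N) (2 * y) := (ih _).comp (by fun_prop)
    have h2 : Measurable fun y : ℝ => haarTree N i (2 * y - 1) := (ih _).comp (by fun_prop)
    change Measurable fun y => haarTree (N + 1) i y
    simp only [haarTree]
    refine Measurable.ite (measurableSet_Iio (a := (1 / 2 : ℝ))) ?_ ?_
    · split_ifs
      · exact measurable_const
      · exact h1.const_add _
      · exact h1.const_add _
    · split_ifs
      · exact h2
      · exact measurable_const
      · exact measurable_const

lemma abs_haarTree_le_one (N i : ℕ) (y : ℝ) : |haarTree N i y| ≤ 1 := by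
  induction N generalizing i y with
  | zero => simp [haarTree]
  | succ N ih =>
    have := ih (i - 2 ^ N) (2 * y)
    have := ih i (2 * y - 1)
    unfold haarTree
    split_ifs with h1 h2 h3 <;> simp_all [haarTree_slot_zero]

/-- Integrals over `[0,1]` of a function given separately on the two halves. -/
lemma integral_glue_halves {A B : ℝ → ℝ} (hA : IntervalIntegrable A volume 0 1)
    (hB : IntervalIntegrable B volume 0 1) :
    ∫ y in (0 : ℝ)..1, (if y < 1 / 2 then A (2 * y) else B (2 * y - 1)) =
      ((∫ y in (0 : ℝ)..1, A y) + ∫ y in (0 : ℝ)..1, B y) / 2 := by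
  have hA' : IntervalIntegrable (fun y => A (2 * y)) volume 0 (1 / 2) := by
    simpa using hA.comp_mul_left (c := 2)
  have hB' : IntervalIntegrable (fun y => B (2 * y - 1)) volume (1 / 2) 1 := by
    have h := (hB.comp_sub_right 1).comp_mul_left (c := 2)
    norm_num at h ⊢
    exact h
  have e1 : (fun y => A (2 * y)) =ᵐ[volume.restrict (uIoc 0 (1 / 2 : ℝ))]
      fun y => if y < 1 / 2 then A (2 * y) else B (2 * y - 1) := by
    -- The endpoint `1 / 2` belongs to the other branch and is discarded as a null set.
    rw [uIoc_of_le (by norm_num), ← restrict_Ioo_eq_restrict_Ioc]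
    filter_upwards [ae_restrict_mem measurableSet_Ioo] with y hy
    rw [if_pos hy.2]
  have e2 : (fun y => B (2 * y - 1)) =ᵐ[volume.restrict (uIoc (1 / 2 : ℝ) 1)]
      fun y => if y < 1 / 2 then A (2 * y) else B (2 * y - 1) := by
    rw [uIoc_of_le (by norm_num)]
    filter_upwards [ae_restrict_mem measurableSet_Ioc] with y hy
    rw [if_neg hy.1.not_gt]
  rw [← intervalIntegral.integral_add_adjacent_intervals (hA'.congr_ae e1) (hB'.congr_ae e2),
    ← intervalIntegral.integral_congr_ae_restrict e1,
    ← intervalIntegral.integral_congr_ae_restrict e2,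
    intervalIntegral.integral_comp_mul_left A (two_ne_zero),
    intervalIntegral.integral_comp_mul_sub B (two_ne_zero)]
  norm_num
  ring

lemma intervalIntegrable_of_measurable_of_bound {f : ℝ → ℝ} (hf : Measurable f) (C : ℝ)
    (hC : ∀ y, |f y| ≤ C) : IntervalIntegrable f volume 0 1 := by
  rw [intervalIntegrable_iff]
  exact Measure.integrableOn_of_bounded (M := C) (by simp) hf.aestronglyMeasurable
    (ae_of_all _ hC)

lemma intervalIntegrable_haarTree (N i : ℕ) : IntervalIntegrable (haarTree N i) volume 0 1 :=
  intervalIntegrable_of_measurable_of_bound (measurable_haarTree N i) 1 (abs_haarTree_le_one N i)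

lemma intervalIntegrable_haarTree_mul (N i j : ℕ) :
    IntervalIntegrable (fun y => haarTree N i y * haarTree N j y) volume 0 1 :=
  intervalIntegrable_of_measurable_of_bound
    ((measurable_haarTree N i).mul (measurable_haarTree N j)) 1 fun y => by
      rw [abs_mul]
      exact mul_le_one₀ (abs_haarTree_le_one N i y) (abs_nonneg _) (abs_haarTree_le_one N j y)

lemma integral_haarTree (N i : ℕ) : ∫ y in (0 : ℝ)..1, haarTree N i y = 0 := by
  induction N generalizing i with
  | zero => simp [haarTree]
  | succ N ih =>
    unfold haarTree
    rcases lt_trichotomy i (2 ^ N) with h | h | h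
    · have := integral_glue_halves (A := fun _ => 0) (B := haarTree N i) (by simp)
        (intervalIntegrable_haarTree N i)
      simp only [if_pos h]
      rw [this, ih]; simp
    · have := integral_glue_halves (A := fun _ => 1) (B := fun _ => -1) (by simp) (by simp)
      subst h
      simp only [lt_irrefl, if_false, if_true, Nat.sub_self, haarTree_slot_zero, add_zero]
      rw [this]; simp
    · have := integral_glue_halves (A := haarTree N (i - 2 ^ N)) (B := fun _ => 0)
        (intervalIntegrable_haarTree N _) (by simp)
      simp only [if_neg h.not_gt, if_neg h.ne', zero_add]
      rw [this, ih]; simp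

lemma integral_haarTree_mul_of_lt (N : ℕ) {i j : ℕ} (hij : i < j) :
    ∫ y in (0 : ℝ)..1, haarTree N i y * haarTree N j y = 0 := by
  induction N generalizing i j with
  | zero => simp [haarTree]
  | succ N ih =>
    have key : ∀ A B : ℝ → ℝ, IntervalIntegrable A volume 0 1 → IntervalIntegrable B volume 0 1 →
        (∀ y, haarTree (N + 1) i y * haarTree (N + 1) j y =
          if y < 1 / 2 then A (2 * y) else B (2 * y - 1)) →
        ∫ y in (0 : ℝ)..1, A y = 0 → ∫ y in (0 : ℝ)..1, B y = 0 →
        ∫ y in (0 : ℝ)..1, haarTree (N + 1) i y * haarTree (N + 1) j y = 0 := by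
      intro A B hA hB h h1 h2
      simp only [h]
      rw [integral_glue_halves hA hB, h1, h2]; simp
    have hz : IntervalIntegrable (fun _ : ℝ => (0 : ℝ)) volume 0 1 := by simp
    -- Numbers below `2 ^ N` live on the right half, those above on the left half, and `2 ^ N` is
    -- the root. Two functions on one half are handled by induction, those on opposite halves have
    -- disjoint supports, and the root is constant on each half, where the other function has mean
    -- zero.
    rcases lt_trichotomy j (2 ^ N) with h | h | h
    · refine key (fun _ => 0) (fun y => haarTree N i y * haarTree N j y) hz
        (intervalIntegrable_haarTree_mul N i j) (fun y => ?_) (by simp) (ih hij)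
      by_cases hy : y < 1 / 2 <;> simp [-one_div, haarTree, hy, h, hij.trans h]
    · refine key (fun _ => 0) (fun y => -haarTree N i y) hz
        (intervalIntegrable_haarTree N i).neg (fun y => ?_) (by simp) (by simp [integral_haarTree])
      subst h
      by_cases hy : y < 1 / 2 <;> simp [-one_div, haarTree, hy, hij]
    · rcases lt_trichotomy i (2 ^ N) with h' | h' | h'
      · refine key (fun _ => 0) (fun _ => 0) hz hz (fun y => ?_) (by simp) (by simp)
        by_cases hy : y < 1 / 2 <;>
          simp [-one_div, haarTree, hy, h', h.not_gt, h.ne']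
      · refine key (haarTree N (j - 2 ^ N)) (fun _ => 0) (intervalIntegrable_haarTree N _) hz
          (fun y => ?_) (integral_haarTree _ _) (by simp)
        subst h'
        by_cases hy : y < 1 / 2 <;>
          simp [-one_div, haarTree, hy, h.not_gt, h.ne', haarTree_slot_zero]
      · refine key (fun y => haarTree N (i - 2 ^ N) y * haarTree N (j - 2 ^ N) y) (fun _ => 0)
          (intervalIntegrable_haarTree_mul N _ _) hz (fun y => ?_) (ih (by omega)) (by simp)
        by_cases hy : y < 1 / 2 <;>
          simp [-one_div, haarTree, hy, h.not_gt, h.ne', h'.not_gt, h'.ne']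

lemma integral_haarTree_mul (N : ℕ) {i j : ℕ} (hij : i ≠ j) :
    ∫ y in (0 : ℝ)..1, haarTree N i y * haarTree N j y = 0 := by
  rcases hij.lt_or_gt with h | h
  · exact integral_haarTree_mul_of_lt N h
  · simpa only [mul_comm] using integral_haarTree_mul_of_lt N h

/-- Exactly one function of each level is nonzero at `y`, with value `±1`. -/
lemma sum_sq_haarTree (N : ℕ) (y : ℝ) : ∑ i ∈ Finset.range (2 ^ N), haarTree N i y ^ 2 = N := by
  induction N generalizing y with
  | zero => simp [haarTree]
  | succ N ih =>
    have hsum : ∀ f : ℕ → ℝ, ∑ i ∈ Finset.range (2 ^ N), (if i = 0 then f i else 0) = f 0 := by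
      intro f
      rw [Finset.sum_ite_eq' (Finset.range (2 ^ N)) 0 f, if_pos (by simp)]
    rw [pow_succ, mul_two, Finset.sum_range_add]
    by_cases hy : y < 1 / 2
    · have h1 : ∀ i ∈ Finset.range (2 ^ N), haarTree (N + 1) i y ^ 2 = 0 := fun i hi => by
        simp [-one_div, haarTree, hy, Finset.mem_range.1 hi]
      have h2 : ∀ i ∈ Finset.range (2 ^ N), haarTree (N + 1) (2 ^ N + i) y ^ 2 =
          (if i = 0 then 1 else 0) + haarTree N i (2 * y) ^ 2 := fun i _ => by
        rcases eq_or_ne i 0 with rfl | h0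
        · simp [-one_div, haarTree, hy, haarTree_slot_zero]
        · simp [-one_div, haarTree, hy, h0]
      rw [Finset.sum_congr rfl h1, Finset.sum_congr rfl h2, Finset.sum_add_distrib, ih,
        hsum fun _ => 1]
      simp [add_comm]
    · have h1 : ∀ i ∈ Finset.range (2 ^ N), haarTree (N + 1) i y ^ 2 =
          haarTree N i (2 * y - 1) ^ 2 := fun i hi => by
        simp [-one_div, haarTree, hy, Finset.mem_range.1 hi]
      have h2 : ∀ i ∈ Finset.range (2 ^ N), haarTree (N + 1) (2 ^ N + i) y ^ 2 =
          if i = 0 then 1 else 0 := fun i _ => by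
        rcases eq_or_ne i 0 with rfl | h0
        · simp [-one_div, haarTree, hy]
        · simp [-one_div, haarTree, hy, h0]
      rw [Finset.sum_congr rfl h1, Finset.sum_congr rfl h2, ih, hsum fun _ => 1]
      simp

/-- At every point, the partial sum over the supports whose right end is still to come collects all
positive values, so it differs from half of the full sum by half of the number of levels. -/
lemma exists_partial_sum_haarTree (N : ℕ) (y : ℝ) :
    ∃ k, 1 ≤ k ∧ k ≤ 2 ^ N ∧ 2 * ∑ i ∈ Finset.range k, haarTree N i y -
      ∑ i ∈ Finset.range (2 ^ N), haarTree N i y = N := by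
  induction N generalizing y with
  | zero => exact ⟨1, le_rfl, by simp, by simp [haarTree]⟩
  | succ N ih =>
    have hsum : ∀ (k : ℕ) (c : ℝ), 1 ≤ k →
        ∑ i ∈ Finset.range k, (if i = 0 then c else 0) = c := by
      intro k c hk
      rw [Finset.sum_ite_eq' (Finset.range k) 0 fun _ => c, if_pos (Finset.mem_range.2 hk)]
    have hpos : 1 ≤ 2 ^ N := Nat.one_le_two_pow
    by_cases hy : y < 1 / 2
    · obtain ⟨k, hk1, hk, h⟩ := ih (2 * y)
      have h1 : ∑ i ∈ Finset.range (2 ^ N), haarTree (N + 1) i y = 0 :=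
        Finset.sum_eq_zero fun i hi => by simp [-one_div, haarTree, hy, Finset.mem_range.1 hi]
      have h2 : ∀ k, 1 ≤ k → ∑ i ∈ Finset.range k, haarTree (N + 1) (2 ^ N + i) y =
          1 + ∑ i ∈ Finset.range k, haarTree N i (2 * y) := fun k hk => by
        rw [← hsum k 1 hk, ← Finset.sum_add_distrib]
        exact Finset.sum_congr rfl fun i _ => by simp [-one_div, haarTree, hy]
      refine ⟨2 ^ N + k, by omega, by rw [pow_succ]; omega, ?_⟩
      rw [pow_succ, mul_two, Finset.sum_range_add, Finset.sum_range_add, h1, h2 k hk1, h2 _ hpos]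
      push_cast
      linarith
    · obtain ⟨k, hk1, hk, h⟩ := ih (2 * y - 1)
      have h1 : ∀ k ≤ 2 ^ N, ∑ i ∈ Finset.range k, haarTree (N + 1) i y =
          ∑ i ∈ Finset.range k, haarTree N i (2 * y - 1) := fun k hk =>
        Finset.sum_congr rfl fun i hi => by
          simp [-one_div, haarTree, hy, (Finset.mem_range.1 hi).trans_le hk]
      have h2 : ∑ i ∈ Finset.range (2 ^ N), haarTree (N + 1) (2 ^ N + i) y = -1 := by
        rw [← hsum _ (-1) hpos]
        exact Finset.sum_congr rfl fun i _ => by simp [-one_div, haarTree, hy]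
      refine ⟨k, hk1, by rw [pow_succ]; omega, ?_⟩
      rw [pow_succ, mul_two, Finset.sum_range_add, h1 k hk, h1 _ le_rfl, h2]
      push_cast
      linarith

/-! ### Unitary maps of finite-rank perturbation type -/

section Hilbert

variable {E : Type*} [NormedAddCommGroup E] [InnerProductSpace ℝ E]

/-- A reflection that takes `p` to `q`, written as a perturbation of the identity of rank one. -/
lemma exists_reflection_map_eq {p q : E} (h : ‖p‖ = ‖q‖) :
    ∃ R : E ≃ₗᵢ[ℝ] E, R p = q ∧ (∀ z, ⟪p, z⟫ = 0 → ⟪q, z⟫ = 0 → R z = z) ∧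
      ∃ v v' : E, ∀ f, R f = f - ⟪v, f⟫ • v' := by
  -- For `p = q` the formula survives because both sides reduce to `f`.
  have hform : ∀ f, (ℝ ∙ (p - q))ᗮ.reflection f = f - ⟪p - q, f⟫ • ((2 / ‖p - q‖ ^ 2) • (p - q)) := by
    intro f
    rw [Submodule.reflection_orthogonal_apply, Submodule.reflection_singleton_apply, smul_smul]
    simp only [RCLike.ofReal_real_eq_id, id_eq]
    rw [two_smul, ← add_smul, neg_sub]
    congr 2
    ring
  refine ⟨(ℝ ∙ (p - q))ᗮ.reflection, Submodule.reflection_sub h, fun z h1 h2 => ?_, _, _, hform⟩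
  rw [hform, inner_sub_left, h1, h2]
  simp

/-- A unitary map that takes two prescribed vectors to two prescribed vectors and fixes a third
one, written as a perturbation of the identity of rank two. -/
lemma exists_isometryEquiv_map_eq {a p₀ q₀ p₁ q₁ : E} (h₀ : ‖p₀‖ = ‖q₀‖) (h₁ : ‖p₁‖ = ‖q₁‖)
    (hp₀ : ⟪p₀, a⟫ = 0) (hq₀ : ⟪q₀, a⟫ = 0) (hp₁ : ⟪p₁, a⟫ = 0) (hq₁ : ⟪q₁, a⟫ = 0)
    (hp : ⟪p₁, p₀⟫ = 0) (hq : ⟪q₁, q₀⟫ = 0) :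
    ∃ R : E ≃ₗᵢ[ℝ] E, R a = a ∧ R p₀ = q₀ ∧ R p₁ = q₁ ∧
      ∃ u u' v v' : E, ∀ f, R f = f - ⟪u, f⟫ • u' - ⟪v, f⟫ • v' := by
  obtain ⟨R, hRp, hR, u, u', hu⟩ := exists_reflection_map_eq h₀
  have hRa : R a = a := hR a hp₀ hq₀
  -- The second reflection keeps `a` and `q₀`: `R p₁` is orthogonal to `R a = a` and `R p₀ = q₀`,
  -- because `R` is unitary.
  obtain ⟨T, hTp, hT, v, v', hv⟩ :=
    exists_reflection_map_eq (p := R p₁) (q := q₁) (by rw [R.norm_map, h₁])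
  refine ⟨R.trans T, ?_, ?_, ?_, u, u', R.symm v, v', fun f => ?_⟩
  · rw [LinearIsometryEquiv.trans_apply, hRa]
    refine hT a ?_ hq₁
    rw [← hRa, R.inner_map_map, hp₁]
  · rw [LinearIsometryEquiv.trans_apply, hRp]
    refine hT q₀ ?_ hq
    rw [← hRp, R.inner_map_map, hp]
  · rw [LinearIsometryEquiv.trans_apply, hTp]
  · rw [LinearIsometryEquiv.trans_apply, hv, hu f, ← hu f, ← R.symm.inner_map_map,
      R.symm_apply_apply]

lemma Orthonormal.summable_smul_of_summable_sq [CompleteSpace E] {ψ : ℕ → E}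
    (hψ : Orthonormal ℝ ψ) {c : ℕ → ℝ} (hc : Summable fun n => c n ^ 2) :
    Summable fun n => c n • ψ n := by
  have := (hψ.orthogonalFamily.summable_iff_norm_sq_summable c).2 (by simpa using hc)
  simpa using this

end Hilbert

/-! ### Subsequences and upper limits -/

lemma Nat.sum_range_count_nth {M : Type*} [AddCommMonoid M] (p : ℕ → Prop) [DecidablePred p]
    (f : ℕ → M) (n : ℕ) :
    ∑ i ∈ Finset.range (Nat.count p n), f (Nat.nth p i) =
      ∑ k ∈ Finset.range n, if p k then f k else 0 := by
  induction n with
  | zero => simp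
  | succ n ih =>
    rw [Finset.sum_range_succ, Nat.count_succ, ← ih]
    split_ifs with h
    · rw [Finset.sum_range_succ, Nat.nth_count h]
    · simp

lemma EReal.limsup_coe_abs_eq_top {s : ℕ → ℝ} (hs : ¬ ∃ B, ∀ n, |s n| ≤ B) :
    limsup (fun n => ((|s n| : ℝ) : EReal)) atTop = ⊤ := by
  rw [EReal.eq_top_iff_forall_lt]
  intro y
  by_contra! h
  have h1 : ∀ᶠ n in atTop, ((|s n| : ℝ) : EReal) < ((y + 1 : ℝ) : EReal) :=
    eventually_lt_of_limsup_lt (lt_of_le_of_lt h (by exact_mod_cast lt_add_one y))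
  obtain ⟨m, hm⟩ := eventually_atTop.1 h1
  refine hs ⟨max (y + 1) (∑ n ∈ Finset.range m, |s n|), fun n => ?_⟩
  rcases lt_or_ge n m with hn | hn
  · exact le_max_of_le_right
      (Finset.single_le_sum (f := fun n => |s n|) (fun _ _ => abs_nonneg _) (Finset.mem_range.2 hn))
  · exact le_max_of_le_left (by exact_mod_cast (hm n hn).le)

/-! ### Independent blocks and the divergent series -/

open ProbabilityTheory in
/-- Lebesgue measure on `[0,1]` carries a sequence of independent uniform variables. -/
lemma exists_iIndepFun_uniform :
    ∃ X : ℕ → ℝ → ℝ, (∀ j, Measurable (X j)) ∧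
      (∀ j, (volume.restrict (Icc (0 : ℝ) 1)).map (X j) = volume.restrict (Icc (0 : ℝ) 1)) ∧
      iIndepFun X (volume.restrict (Icc (0 : ℝ) 1)) := by
  set μ : Measure ℝ := volume.restrict (Icc (0 : ℝ) 1) with hμ
  have : IsProbabilityMeasure μ := ⟨by simp [hμ]⟩
  obtain ⟨T, hT, hTmap⟩ := (Measure.infinitePi fun _ : ℕ => μ).exists_measurable_map_eq
  -- `T` is defined on the unit interval as a type; the projection carries it over to `ℝ` with
  -- restricted Lebesgue measure.
  have hproj : Measurable (projIcc (0 : ℝ) 1 zero_le_one) := continuous_projIcc.measurable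
  have hprojmap : μ.map (projIcc (0 : ℝ) 1 zero_le_one) = volume := by
    rw [hμ, ← unitInterval.measurePreserving_coe.map_eq, Measure.map_map hproj measurable_subtype_coe]
    have : projIcc (0 : ℝ) 1 zero_le_one ∘ Subtype.val = id := by
      ext x; simp
    rw [this, Measure.map_id]
  have hmeas : Measurable fun x => T (projIcc (0 : ℝ) 1 zero_le_one x) := hT.comp hproj
  have hmap : μ.map (fun x => T (projIcc (0 : ℝ) 1 zero_le_one x)) =
      Measure.infinitePi fun _ : ℕ => μ := by
    rw [← hTmap, ← hprojmap, Measure.map_map hT hproj]; rfl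
  have hX : ∀ j, Measurable fun x => T (projIcc (0 : ℝ) 1 zero_le_one x) j := fun j =>
    (measurable_pi_apply j).comp hmeas
  have hXmap : ∀ j, μ.map (fun x => T (projIcc (0 : ℝ) 1 zero_le_one x) j) = μ := fun j => by
    have := Measure.infinitePi_map_eval (fun _ : ℕ => μ) j
    rwa [← hmap, Measure.map_map (measurable_pi_apply j) hmeas] at this
  refine ⟨fun j x => T (projIcc (0 : ℝ) 1 zero_le_one x) j, hX, hXmap, ?_⟩
  rw [iIndepFun_iff_map_fun_eq_infinitePi_map hX]
  simp only [hXmap]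
  exact hmap

/-- The weights `8 ^ (-l)` at the places `16 ^ l`, and `0` elsewhere. -/
noncomputable def sparseWeight : ℕ → ℝ :=
  Function.extend (fun l : ℕ => 16 ^ l) (fun l => (1 / 8 : ℝ) ^ l) 0

lemma sparseWeight_pow (l : ℕ) : sparseWeight (16 ^ l) = (1 / 8 : ℝ) ^ l :=
  (Nat.pow_right_injective (by norm_num : 2 ≤ 16)).extend_apply _ _ l

/-- At `j = 16 ^ l` the energy `w² j` is `4 ^ (-l)`, while `w j = 2 ^ l` is unbounded; the latter
drives the divergence. -/
lemma summable_sparseWeight_sq_mul : Summable fun j : ℕ => sparseWeight j ^ 2 * j := by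
  have hinj : Function.Injective fun l : ℕ => 16 ^ l := Nat.pow_right_injective (by norm_num)
  rw [← hinj.summable_iff]
  · have : ((fun j : ℕ => sparseWeight j ^ 2 * j) ∘ fun l : ℕ => 16 ^ l) =
        fun l => (1 / 4 : ℝ) ^ l := by
      ext l
      simp only [Function.comp_apply, sparseWeight_pow]
      push_cast
      rw [← pow_mul, mul_comm l 2, pow_mul, ← mul_pow]
      norm_num
    rw [this]
    exact summable_geometric_of_lt_one (by norm_num) (by norm_num)
  · intro j hj
    have : sparseWeight j = 0 := Function.extend_apply' _ _ _ hj
    simp [this]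

/-- The functions of the `j`-th block, which carries the numbers from `2 ^ j` to
`2 ^ (j + 1) - 1`, are the weighted functions `haarTree j` of the variable `X j`. -/
noncomputable def blockHaar (X : ℕ → ℝ → ℝ) (n : ℕ) (x : ℝ) : ℝ :=
  sparseWeight (Nat.log 2 n) * haarTree (Nat.log 2 n) (n - 2 ^ Nat.log 2 n) (X (Nat.log 2 n) x)

lemma blockHaar_block (X : ℕ → ℝ → ℝ) {j i : ℕ} (hi : i < 2 ^ j) (x : ℝ) :
    blockHaar X (2 ^ j + i) x = sparseWeight j * haarTree j i (X j x) := by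
  have : Nat.log 2 (2 ^ j + i) = j :=
    Nat.log_eq_of_pow_le_of_lt_pow (by omega) (by rw [pow_succ]; omega)
  rw [blockHaar, this, Nat.add_sub_cancel_left]

lemma sum_blockHaar_block (X : ℕ → ℝ → ℝ) {j k : ℕ} (hk : k ≤ 2 ^ j) (x : ℝ) :
    ∑ n ∈ Finset.range (2 ^ j + k), blockHaar X n x =
      ∑ n ∈ Finset.range (2 ^ j), blockHaar X n x +
        sparseWeight j * ∑ i ∈ Finset.range k, haarTree j i (X j x) := by
  rw [Finset.sum_range_add, Finset.mul_sum]
  congr 1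
  exact Finset.sum_congr rfl fun i hi =>
    blockHaar_block X ((Finset.mem_range.1 hi).trans_le hk) x

lemma not_bounded_sum_blockHaar (X : ℕ → ℝ → ℝ) (x : ℝ) :
    ¬ ∃ B, ∀ n, |∑ k ∈ Finset.range n, blockHaar X k x| ≤ B := by
  rintro ⟨B, hB⟩
  obtain ⟨l, hl⟩ := pow_unbounded_of_one_lt (6 * B) (one_lt_two)
  obtain ⟨k, -, hk, h⟩ := exists_partial_sum_haarTree (16 ^ l) (X (16 ^ l) x)
  -- With `S₁, S₂, S₃` the partial sums at the start, an inner point and the end of the block, `2 S₂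
  -- - S₁ - S₃ = 2 ^ l`, which is at most `4 B`.
  have h1 := abs_le.1 (hB (2 ^ (16 ^ l)))
  have h2 := abs_le.1 (hB (2 ^ (16 ^ l) + k))
  have h3 := abs_le.1 (hB (2 ^ (16 ^ l) + 2 ^ (16 ^ l)))
  rw [sum_blockHaar_block X hk] at h2
  rw [sum_blockHaar_block X le_rfl] at h3
  have h4 : sparseWeight (16 ^ l) * ((16 ^ l : ℕ) : ℝ) = 2 ^ l := by
    rw [sparseWeight_pow]
    push_cast
    rw [← mul_pow]
    norm_num
  rw [← h, mul_sub, mul_left_comm] at h4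
  linarith

lemma measurable_blockHaar {X : ℕ → ℝ → ℝ} (hX : ∀ j, Measurable (X j)) (n : ℕ) : Measurable (blockHaar X n) :=
  ((measurable_haarTree _ _).comp (hX _)).const_mul _

lemma integral_comp_uniform {X : ℕ → ℝ → ℝ} (hX : ∀ j, Measurable (X j))
    (hmap : ∀ j, (volume.restrict (Icc (0 : ℝ) 1)).map (X j) = volume.restrict (Icc (0 : ℝ) 1))
    {f : ℝ → ℝ} (hf : Measurable f) (j : ℕ) :
    ∫ x in Icc (0 : ℝ) 1, f (X j x) = ∫ y in (0 : ℝ)..1, f y := by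
  rw [← integral_map (hX j).aemeasurable hf.aestronglyMeasurable, hmap,
    intervalIntegral.integral_of_le zero_le_one, integral_Icc_eq_integral_Ioc]

lemma integral_blockHaar {X : ℕ → ℝ → ℝ} (hX : ∀ j, Measurable (X j))
    (hmap : ∀ j, (volume.restrict (Icc (0 : ℝ) 1)).map (X j) = volume.restrict (Icc (0 : ℝ) 1))
    (n : ℕ) : ∫ x in Icc (0 : ℝ) 1, blockHaar X n x = 0 := by
  simp only [blockHaar]
  rw [integral_const_mul, integral_comp_uniform hX hmap (measurable_haarTree _ _),
    integral_haarTree, mul_zero]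

lemma integral_blockHaar_mul {X : ℕ → ℝ → ℝ} (hX : ∀ j, Measurable (X j))
    (hmap : ∀ j, (volume.restrict (Icc (0 : ℝ) 1)).map (X j) = volume.restrict (Icc (0 : ℝ) 1))
    (hind : ProbabilityTheory.iIndepFun X (volume.restrict (Icc (0 : ℝ) 1))) {m n : ℕ}
    (hmn : m ≠ n) : ∫ x in Icc (0 : ℝ) 1, blockHaar X m x * blockHaar X n x = 0 := by
  rcases eq_or_ne (Nat.log 2 m) (Nat.log 2 n) with h | h
  · simp only [blockHaar, h, mul_mul_mul_comm]
    rw [integral_const_mul, integral_comp_uniform hX hmap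
      (f := fun y => haarTree _ _ y * haarTree _ _ y)
      ((measurable_haarTree _ _).mul (measurable_haarTree _ _))]
    -- Because `Nat.log 2 0 = 0` and subtraction truncates, `0` and `1` share block and slot; that
    -- slot holds the zero function.
    rcases eq_or_ne (m - 2 ^ Nat.log 2 n) (n - 2 ^ Nat.log 2 n) with h' | h'
    · have hle : ∀ k, k ≠ 0 → 2 ^ Nat.log 2 k ≤ k := fun k hk => Nat.pow_log_le_self 2 hk
      have : n - 2 ^ Nat.log 2 n = 0 := by
        rcases Nat.eq_zero_or_pos n with rfl | hn
        · simp
        rcases Nat.eq_zero_or_pos m with rfl | hm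
        · rw [← h']; simp
        have h1 := hle n hn.ne'
        have h2 := hle m hm.ne'
        rw [h] at h2
        omega
      simp [h', this, haarTree_slot_zero]
    · rw [integral_haarTree_mul _ h', mul_zero]
  · have := ((hind.indepFun h).comp
      ((measurable_haarTree (Nat.log 2 m) (m - 2 ^ Nat.log 2 m)).const_mul
        (sparseWeight (Nat.log 2 m)))
      ((measurable_haarTree (Nat.log 2 n) (n - 2 ^ Nat.log 2 n)).const_mul
        (sparseWeight (Nat.log 2 n)))).integral_fun_mul_eq_mul_integral
      (measurable_blockHaar hX m).aestronglyMeasurable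
      (measurable_blockHaar hX n).aestronglyMeasurable
    refine this.trans ?_
    have h0 := integral_blockHaar hX hmap m
    simp only [blockHaar] at h0
    simp [h0]

lemma summable_integral_blockHaar_sq {X : ℕ → ℝ → ℝ} (hX : ∀ j, Measurable (X j))
    (hmap : ∀ j, (volume.restrict (Icc (0 : ℝ) 1)).map (X j) = volume.restrict (Icc (0 : ℝ) 1)) :
    Summable fun n => ∫ x in Icc (0 : ℝ) 1, blockHaar X n x ^ 2 := by
  have hnonneg : ∀ n, 0 ≤ ∫ x in Icc (0 : ℝ) 1, blockHaar X n x ^ 2 := fun n =>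
    integral_nonneg fun x => sq_nonneg _
  have hblock : ∀ j, ∑ i ∈ Finset.range (2 ^ j),
      ∫ x in Icc (0 : ℝ) 1, blockHaar X (2 ^ j + i) x ^ 2 = sparseWeight j ^ 2 * j := by
    intro j
    have : ∀ i ∈ Finset.range (2 ^ j), ∫ x in Icc (0 : ℝ) 1, blockHaar X (2 ^ j + i) x ^ 2 =
        sparseWeight j ^ 2 * ∫ y in (0 : ℝ)..1, haarTree j i y ^ 2 := fun i hi => by
      simp only [blockHaar_block X (Finset.mem_range.1 hi), mul_pow]
      rw [integral_const_mul, integral_comp_uniform hX hmap (f := fun y => haarTree j i y ^ 2)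
        ((measurable_haarTree _ _).pow_const 2)]
    rw [Finset.sum_congr rfl this, ← Finset.mul_sum, ← intervalIntegral.integral_finsetSum]
    · simp [sum_sq_haarTree]
    · intro i _
      simpa only [sq] using intervalIntegrable_haarTree_mul j i i
  have hpow : ∀ J, ∑ n ∈ Finset.range (2 ^ J), ∫ x in Icc (0 : ℝ) 1, blockHaar X n x ^ 2 =
      ∑ j ∈ Finset.range J, sparseWeight j ^ 2 * j := by
    intro J
    induction J with
    | zero => simp [blockHaar, haarTree]
    | succ J ih => rw [pow_succ, mul_two, Finset.sum_range_add, ih, hblock, Finset.sum_range_succ]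
  refine summable_of_sum_range_le hnonneg (c := ∑' j : ℕ, sparseWeight j ^ 2 * j) fun n => ?_
  calc _ ≤ ∑ n ∈ Finset.range (2 ^ n), ∫ x in Icc (0 : ℝ) 1, blockHaar X n x ^ 2 :=
        Finset.sum_le_sum_of_subset_of_nonneg
          (Finset.range_subset_range.2 Nat.lt_two_pow_self.le) fun _ _ _ => hnonneg _
    _ = _ := hpow n
    _ ≤ _ := summable_sparseWeight_sq_mul.sum_le_tsum _ fun j _ => by positivity

lemma abs_blockHaar_le (X : ℕ → ℝ → ℝ) (n : ℕ) (x : ℝ) :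
    |blockHaar X n x| ≤ |sparseWeight (Nat.log 2 n)| := by
  rw [blockHaar, abs_mul]
  exact mul_le_of_le_one_right (abs_nonneg _) (abs_haarTree_le_one _ _ _)

/-- An orthonormal system of mean zero on `[0,1]` together with a square summable sequence of
nonzero coefficients whose series has unbounded partial sums almost everywhere. -/
lemma exists_orthonormal_unbounded :
    ∃ (ψ : ℕ → Lp ℝ 2 (volume.restrict (Icc (0 : ℝ) 1))) (c : ℕ → ℝ), Orthonormal ℝ ψ ∧
      (∀ n, ∫ x in Icc (0 : ℝ) 1, ψ n x = 0) ∧ (∀ n, c n ≠ 0) ∧ (Summable fun n => c n ^ 2) ∧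
      ∀ᵐ x ∂(volume.restrict (Icc (0 : ℝ) 1)),
        ¬ ∃ B, ∀ n, |∑ k ∈ Finset.range n, c k * ψ k x| ≤ B := by
  classical
  obtain ⟨X, hX, hmap, hind⟩ := exists_iIndepFun_uniform
  set μ : Measure ℝ := volume.restrict (Icc (0 : ℝ) 1) with hμ
  have hμprob : IsProbabilityMeasure μ := ⟨by simp [hμ]⟩
  have hL : ∀ n, MemLp (blockHaar X n) 2 μ := fun n =>
    MemLp.of_bound (measurable_blockHaar hX n).aestronglyMeasurable _
      (ae_of_all _ fun x => abs_blockHaar_le X n x)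
  let y : ℕ → Lp ℝ 2 μ := fun n => (hL n).toLp
  have hy : ∀ n, y n =ᵐ[μ] blockHaar X n := fun n => (hL n).coeFn_toLp
  have hinner : ∀ m n, ⟪y m, y n⟫ = ∫ x in Icc (0 : ℝ) 1, blockHaar X m x * blockHaar X n x := by
    intro m n
    rw [L2.inner_def]
    refine integral_congr_ae ?_
    filter_upwards [hy m, hy n] with x h1 h2
    rw [h1, h2, real_inner_eq_re_inner]
    simp [mul_comm]
  have hnorm : ∀ n, ‖y n‖ ^ 2 = ∫ x in Icc (0 : ℝ) 1, blockHaar X n x ^ 2 := fun n => by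
    rw [← real_inner_self_eq_norm_sq, hinner]
    simp only [sq]
  have hyae : ∀ᵐ x ∂μ, ∀ n, y n x = blockHaar X n x := ae_all_iff.2 hy
  have hzero : ∀ᵐ x ∂μ, ∀ n, y n = 0 → blockHaar X n x = 0 := by
    filter_upwards [hyae, Lp.coeFn_zero ℝ 2 μ] with x h1 h2 n hn
    rw [← h1, hn, h2]; rfl
  -- Functions vanishing in `L₂` (slot `0`, blocks of weight zero) cannot be normalised. They are
  -- dropped, which leaves the set of values of the partial sums unchanged almost everywhere.
  let p : ℕ → Prop := fun n => y n ≠ 0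
  have hinf : (Set.ofPred p).Infinite := by
    intro hfin
    obtain ⟨x, hx⟩ := hzero.exists
    refine not_bounded_sum_blockHaar X x
      ⟨∑ k ∈ hfin.toFinset, |blockHaar X k x|, fun n => ?_⟩
    refine (Finset.abs_sum_le_sum_abs _ _).trans ?_
    rw [← Finset.sum_filter_of_ne (p := p)]
    · refine Finset.sum_le_sum_of_subset_of_nonneg (fun k hk => ?_) fun _ _ _ => abs_nonneg _
      simpa using (Finset.mem_filter.1 hk).2
    · intro k _ hk hk'
      exact hk (by simp [hx k hk'])
  have hp : ∀ k, y (Nat.nth p k) ≠ 0 := Nat.nth_mem_of_infinite hinf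
  have hc : ∀ k, ‖y (Nat.nth p k)‖ ≠ 0 := fun k => norm_ne_zero_iff.2 (hp k)
  have hψ : ∀ k, ((‖y (Nat.nth p k)‖⁻¹ • y (Nat.nth p k) : Lp ℝ 2 μ) : ℝ → ℝ) =ᵐ[μ]
      fun x => ‖y (Nat.nth p k)‖⁻¹ * blockHaar X (Nat.nth p k) x := fun k => by
    filter_upwards [Lp.coeFn_smul ‖y (Nat.nth p k)‖⁻¹ (y (Nat.nth p k)), hyae] with x h1 h2
    rw [h1, Pi.smul_apply, h2, smul_eq_mul]
  refine ⟨fun k => ‖y (Nat.nth p k)‖⁻¹ • y (Nat.nth p k), fun k => ‖y (Nat.nth p k)‖,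
    ⟨fun k => ?_, fun j k hjk => ?_⟩, fun k => ?_, hc, ?_, ?_⟩
  · simp [norm_smul, hc k]
  · dsimp only
    rw [real_inner_smul_left, real_inner_smul_right, hinner,
      integral_blockHaar_mul hX hmap hind ((Nat.nth_injective hinf).ne hjk)]
    simp
  · rw [integral_congr_ae (hψ k), integral_const_mul, integral_blockHaar hX hmap, mul_zero]
  · simp only [hnorm]
    exact (summable_integral_blockHaar_sq hX hmap).comp_injective (Nat.nth_injective hinf)
  · filter_upwards [hzero, ae_all_iff.2 hψ] with x h1 h2
    rintro ⟨B, hB⟩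
    refine not_bounded_sum_blockHaar X x ⟨B, fun n => ?_⟩
    convert hB (Nat.count p n) using 2
    have : ∀ k, ‖y (Nat.nth p k)‖ *
        (‖y (Nat.nth p k)‖⁻¹ • y (Nat.nth p k) : Lp ℝ 2 μ) x = blockHaar X (Nat.nth p k) x :=
      fun k => by rw [h2, mul_inv_cancel_left₀ (hc k)]
    simp only [this]
    rw [Nat.sum_range_count_nth p fun k => blockHaar X k x]
    refine Finset.sum_congr rfl fun k _ => ?_
    split_ifs with h
    · rfl
    · exact h1 k (not_not.1 h)

/-! ### Monomials in `L₂[0,1]` and the classes of the statement -/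

lemma memLp_pow_Icc (i : ℕ) :
    MemLp (fun u : ℝ => u ^ i) 2 (volume.restrict (Icc (0 : ℝ) 1)) := by
  refine MemLp.of_bound (by fun_prop) 1 ?_
  filter_upwards [ae_restrict_mem measurableSet_Icc] with u hu
  rw [Real.norm_eq_abs, abs_of_nonneg (pow_nonneg hu.1 i)]
  exact pow_le_one₀ hu.1 hu.2

/-- The monomial `u ^ i` as an element of `L₂[0,1]`. -/
noncomputable def powLp (i : ℕ) : Lp ℝ 2 (volume.restrict (Icc (0 : ℝ) 1)) :=
  (memLp_pow_Icc i).toLp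

lemma coeFn_powLp (i : ℕ) :
    powLp i =ᵐ[volume.restrict (Icc (0 : ℝ) 1)] fun u => u ^ i :=
  (memLp_pow_Icc i).coeFn_toLp

lemma integral_mul_eq_inner (f g : Lp ℝ 2 (volume.restrict (Icc (0 : ℝ) 1))) :
    ∫ u in (0 : ℝ)..1, f u * g u = ⟪f, g⟫ := by
  rw [L2.inner_def, intervalIntegral.integral_of_le zero_le_one, ← integral_Icc_eq_integral_Ioc]
  refine integral_congr_ae (ae_of_all _ fun x => ?_)
  dsimp only
  rw [real_inner_eq_re_inner]
  simp [mul_comm]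

lemma integral_pow_mul_eq_inner (i : ℕ) (g : Lp ℝ 2 (volume.restrict (Icc (0 : ℝ) 1))) :
    ∫ u in (0 : ℝ)..1, u ^ i * g u = ⟪powLp i, g⟫ := by
  rw [← integral_mul_eq_inner, intervalIntegral.integral_of_le zero_le_one,
    intervalIntegral.integral_of_le zero_le_one, ← integral_Icc_eq_integral_Ioc,
    ← integral_Icc_eq_integral_Ioc]
  refine integral_congr_ae ?_
  filter_upwards [coeFn_powLp i] with x hx
  rw [hx]

lemma inner_powLp (i j : ℕ) : ⟪powLp i, powLp j⟫ = 1 / ((i : ℝ) + j + 1) := by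
  rw [← integral_pow_mul_eq_inner, intervalIntegral.integral_of_le zero_le_one,
    ← integral_Icc_eq_integral_Ioc]
  rw [integral_congr_ae (g := fun u => u ^ (i + j))]
  · rw [integral_Icc_eq_integral_Ioc, ← intervalIntegral.integral_of_le zero_le_one, integral_pow]
    simp
  · filter_upwards [coeFn_powLp j] with x hx
    rw [hx, pow_add]

lemma sq_mem_classCL : (fun u : ℝ => u ^ 2) ∈ GeneralFourier.classCL := by
  refine ⟨by fun_prop, 2, ?_⟩
  have h : EqOn (derivWithin (fun u : ℝ => u ^ 2) (Icc 0 1)) (fun u => 2 * u) (Icc 0 1) := by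
    intro u hu
    have := ((hasDerivAt_pow 2 u).hasDerivWithinAt (s := Icc 0 1)).derivWithin
      (uniqueDiffOn_Icc zero_lt_one u hu)
    simpa using this
  refine LipschitzOnWith.of_dist_le_mul fun x hx y hy => ?_
  rw [h hx, h hy, Real.dist_eq, Real.dist_eq, ← mul_sub, abs_mul]
  simp

lemma mem_classE_of_coeff_eq_zero {φ : ℕ → ℝ → ℝ} {f : ℝ → ℝ} (hf : GeneralFourier.InL2 f)
    (h : ∀ k, GeneralFourier.coeff φ f k = 0) (x : ℝ) : f ∈ GeneralFourier.classE φ x := by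
  refine ⟨hf, ?_⟩
  have : (fun n => GeneralFourier.partialSum φ n x f) = fun _ => 0 := by
    funext n
    simp [GeneralFourier.partialSum, h]
  rw [this]
  exact isBigO_zero _ _

/-! ### Transfer of divergence and the main theorem -/

/-- If the series of an orthonormal system diverges unboundedly at almost every point, then so does
its image under a perturbation of the identity of rank two. -/
lemma ae_unbounded_of_rank_two {μ : Measure ℝ} {ψ G : ℕ → Lp ℝ 2 μ} {c : ℕ → ℝ}
    {F u u' v v' : Lp ℝ 2 μ} (hF : HasSum (fun n => c n • ψ n) F)
    (hG : ∀ n, G n = ψ n - ⟪u, ψ n⟫ • u' - ⟪v, ψ n⟫ • v')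
    (hψ : ∀ᵐ x ∂μ, ¬ ∃ B, ∀ n, |∑ k ∈ Finset.range n, c k * ψ k x| ≤ B) :
    ∀ᵐ x ∂μ, ¬ ∃ B, ∀ n, |∑ k ∈ Finset.range n, c k * G k x| ≤ B := by
  -- The partial sums converge in `L₂`, so their inner products with `u` and `v` stay bounded.
  obtain ⟨C, hC⟩ := (Metric.isBounded_range_of_tendsto _ hF.tendsto_sum_nat).exists_norm_le
  have hs : ∀ n, ‖∑ k ∈ Finset.range n, c k • ψ k‖ ≤ C := fun n => hC _ ⟨n, rfl⟩
  have hbound : ∀ (w : Lp ℝ 2 μ) n, |∑ k ∈ Finset.range n, c k * ⟪w, ψ k⟫| ≤ ‖w‖ * C := by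
    intro w n
    have : ∑ k ∈ Finset.range n, c k * ⟪w, ψ k⟫ = ⟪w, ∑ k ∈ Finset.range n, c k • ψ k⟫ := by
      simp only [inner_sum, real_inner_smul_right]
    rw [this]
    exact (abs_real_inner_le_norm _ _).trans (mul_le_mul_of_nonneg_left (hs n) (norm_nonneg _))
  have hGae : ∀ᵐ x ∂μ, ∀ n, G n x = ψ n x - ⟪u, ψ n⟫ * u' x - ⟪v, ψ n⟫ * v' x := by
    refine ae_all_iff.2 fun n => ?_
    rw [hG n]
    filter_upwards [Lp.coeFn_sub (ψ n - ⟪u, ψ n⟫ • u') (⟪v, ψ n⟫ • v'),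
      Lp.coeFn_sub (ψ n) (⟪u, ψ n⟫ • u'), Lp.coeFn_smul ⟪u, ψ n⟫ u',
      Lp.coeFn_smul ⟪v, ψ n⟫ v'] with x h1 h2 h3 h4
    rw [h1, Pi.sub_apply, h2, Pi.sub_apply, h3, h4]
    rfl
  filter_upwards [hψ, hGae] with x hx hGx
  rintro ⟨B, hB⟩
  refine hx ⟨B + ‖u‖ * C * |u' x| + ‖v‖ * C * |v' x|, fun n => ?_⟩
  have hsplit : ∑ k ∈ Finset.range n, c k * ψ k x = ∑ k ∈ Finset.range n, c k * G k x +
      (∑ k ∈ Finset.range n, c k * ⟪u, ψ k⟫) * u' x +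
      (∑ k ∈ Finset.range n, c k * ⟪v, ψ k⟫) * v' x := by
    rw [Finset.sum_mul, Finset.sum_mul, ← Finset.sum_add_distrib, ← Finset.sum_add_distrib]
    refine Finset.sum_congr rfl fun k _ => ?_
    rw [hGx]
    ring
  rw [hsplit]
  refine (abs_add_three _ _ _).trans ?_
  rw [abs_mul, abs_mul]
  gcongr
  · exact hB n
  · exact hbound u n
  · exact hbound v n

lemma not_bounded_sum_range_succ {s : ℕ → ℝ}
    (h : ¬ ∃ B, ∀ n, |∑ k ∈ Finset.range n, s k| ≤ B) :
    ¬ ∃ B, ∀ n, |∑ k ∈ Finset.range n, s (k + 1)| ≤ B := by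
  rintro ⟨B, hB⟩
  refine h ⟨B + |s 0|, fun n => ?_⟩
  have hB0 : 0 ≤ B := (abs_nonneg _).trans (hB 0)
  cases n with
  | zero => simpa using add_nonneg hB0 (abs_nonneg _)
  | succ n =>
    rw [Finset.sum_range_succ']
    exact (abs_add_le _ _).trans (by gcongr; exact hB n)

theorem theorem3p3 :
    ∃ g ∈ GeneralFourier.classCL, ∃ G : ℕ → ℝ → ℝ,
      GeneralFourier.IsONS G ∧
      (∀ n, ∫ u in (0 : ℝ)..1, G n u = 0) ∧
      (∀ n, ∫ u in (0 : ℝ)..1, u * G n u = 0) ∧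
      (∀ x ∈ Icc (0 : ℝ) 1,
        (fun _ => (1 : ℝ)) ∈ GeneralFourier.classE G x ∧
        (fun u => u) ∈ GeneralFourier.classE G x) ∧
      ∀ᵐ x ∂(volume.restrict (Icc (0 : ℝ) 1)),
        limsup (fun n => ((|GeneralFourier.partialSum G n x g| : ℝ) : EReal)) atTop = ⊤ := by
  obtain ⟨ψ, c, hψ, hmean, hc0, hc, hunb⟩ := exists_orthonormal_unbounded
  have hψ0 : ∀ n, ⟪ψ n, powLp 0⟫ = 0 := fun n => by
    rw [real_inner_comm, ← integral_pow_mul_eq_inner,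
      intervalIntegral.integral_of_le zero_le_one, ← integral_Icc_eq_integral_Ioc]
    simpa using hmean n
  -- `ψ 0` is held back as the preimage of the direction `u - 1/2`.
  have hψ' : Orthonormal ℝ fun n => ψ (n + 1) := hψ.comp _ (add_left_injective 1)
  obtain ⟨F, hF⟩ : Summable fun n => c (n + 1) • ψ (n + 1) :=
    hψ'.summable_smul_of_summable_sq (hc.comp_injective (add_left_injective 1))
  have hFsum : ∀ z, HasSum (fun n => c (n + 1) * ⟪z, ψ (n + 1)⟫) ⟪z, F⟫ := fun z => by
    simpa [real_inner_smul_right] using hF.mapL (innerSL ℝ z)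
  have hFψ : ∀ n, ⟪F, ψ (n + 1)⟫ = c (n + 1) := fun n => by
    rw [real_inner_comm]
    have hs : HasSum (fun m => c (m + 1) * ⟪ψ (n + 1), ψ (m + 1)⟫)
        (c (n + 1) * ⟪ψ (n + 1), ψ (n + 1)⟫) :=
      hasSum_single n fun m hm => by rw [hψ.2 (by simpa using hm.symm), mul_zero]
    rw [(hFsum _).unique hs, real_inner_self_eq_norm_sq, hψ.1, one_pow, mul_one]
  have hFzero : ∀ z, (∀ n, ⟪z, ψ (n + 1)⟫ = 0) → ⟪F, z⟫ = 0 := fun z hz => by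
    rw [real_inner_comm]
    refine (hFsum z).unique ?_
    simp [hz]
  have hF0 : F ≠ 0 := by
    rintro rfl
    exact hc0 1 (by simpa using (hFψ 0).symm)
  -- `1`, `e`, `h` are the monomials `1`, `u`, `u²` orthogonalised, so `⟪h, u²⟫` below is `‖h‖²`.
  let e := powLp 1 - (1 / 2 : ℝ) • powLp 0
  let h := powLp 2 - powLp 1 + (1 / 6 : ℝ) • powLp 0
  have hh0 : h ≠ 0 := by
    intro hh
    have : ⟪h, powLp 2⟫ = 1 / 180 := by
      simp only [h, inner_add_left, inner_sub_left, real_inner_smul_left, inner_powLp]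
      norm_num
    rw [hh, inner_zero_left] at this
    norm_num at this
  have hFn : ‖F‖ ≠ 0 := norm_ne_zero_iff.2 hF0
  obtain ⟨R, hR0, hR1, hR2, u, u', v, v', hR⟩ := exists_isometryEquiv_map_eq (a := powLp 0)
    (p₀ := ‖e‖ • ψ 0) (q₀ := e) (p₁ := (‖h‖ / ‖F‖) • F) (q₁ := h)
    (by rw [norm_smul, hψ.1]; simp)
    (by rw [norm_smul]; simp [hFn])
    (by rw [real_inner_smul_left, hψ0, mul_zero])
    (by simp only [e, inner_sub_left, real_inner_smul_left, inner_powLp]; norm_num)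
    (by rw [real_inner_smul_left, hFzero _ fun n => by rw [real_inner_comm, hψ0], mul_zero])
    (by
      simp only [h, inner_add_left, inner_sub_left, real_inner_smul_left, inner_powLp]
      norm_num)
    (by
      rw [real_inner_smul_left, real_inner_smul_right,
        hFzero _ fun n => hψ.2 (Nat.succ_ne_zero n).symm]
      simp)
    (by
      simp only [e, h, inner_add_left, inner_sub_left, inner_sub_right, real_inner_smul_left,
        real_inner_smul_right, inner_powLp]
      norm_num)
  have hG0 : ∀ n, ⟪powLp 0, R (ψ (n + 1))⟫ = 0 := fun n => by
    rw [← hR0, R.inner_map_map, real_inner_comm, hψ0]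
  have hG1 : ∀ n, ⟪powLp 1, R (ψ (n + 1))⟫ = 0 := fun n => by
    have h1 : ⟪e, R (ψ (n + 1))⟫ = 0 := by
      rw [← hR1, R.inner_map_map, real_inner_smul_left, hψ.2 (Nat.succ_ne_zero n).symm, mul_zero]
    simpa [e, inner_sub_left, real_inner_smul_left, hG0] using h1
  have hG2 : ∀ n, ⟪powLp 2, R (ψ (n + 1))⟫ = ‖h‖ / ‖F‖ * c (n + 1) := fun n => by
    have h1 : ⟪h, R (ψ (n + 1))⟫ = ‖h‖ / ‖F‖ * c (n + 1) := by
      rw [← hR2, R.inner_map_map, real_inner_smul_left, hFψ, hR2]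
    simpa [h, inner_add_left, inner_sub_left, real_inner_smul_left, hG0, hG1] using h1
  have hI0 : ∀ n, ∫ u in (0 : ℝ)..1, R (ψ (n + 1)) u = 0 := fun n => by
    simpa using (integral_pow_mul_eq_inner 0 (R (ψ (n + 1)))).trans (hG0 n)
  have hI1 : ∀ n, ∫ u in (0 : ℝ)..1, u * R (ψ (n + 1)) u = 0 := fun n => by
    simpa using (integral_pow_mul_eq_inner 1 (R (ψ (n + 1)))).trans (hG1 n)
  refine ⟨fun u => u ^ 2, sq_mem_classCL, fun n => R (ψ (n + 1)), ⟨fun n => Lp.memLp _, ?_⟩,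
    hI0, hI1, fun x _ => ⟨?_, ?_⟩, ?_⟩
  · intro m n
    rw [integral_mul_eq_inner, R.inner_map_map]
    exact orthonormal_iff_ite.1 hψ' m n
  · exact mem_classE_of_coeff_eq_zero (by simpa [GeneralFourier.InL2] using memLp_pow_Icc 0)
      (fun k => by simpa [GeneralFourier.coeff] using hI0 k) x
  · exact mem_classE_of_coeff_eq_zero (by simpa [GeneralFourier.InL2] using memLp_pow_Icc 1)
      (fun k => by simpa [GeneralFourier.coeff] using hI1 k) x
  · have hunb' := ae_unbounded_of_rank_two hF (fun n => hR (ψ (n + 1)))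
      (hunb.mono fun x hx => not_bounded_sum_range_succ hx)
    filter_upwards [hunb'] with x hx
    refine EReal.limsup_coe_abs_eq_top ?_
    rintro ⟨B, hB⟩
    have hκ : 0 < ‖h‖ / ‖F‖ := div_pos (norm_pos_iff.2 hh0) (norm_pos_iff.2 hF0)
    refine hx ⟨B / (‖h‖ / ‖F‖), fun n => ?_⟩
    rw [le_div_iff₀ hκ]
    refine le_of_eq_of_le ?_ (hB n)
    simp only [GeneralFourier.partialSum, GeneralFourier.coeff, integral_pow_mul_eq_inner, hG2,
      mul_assoc, ← Finset.mul_sum]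
    rw [abs_mul, abs_of_pos hκ, mul_comm]
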